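/- **Proposition 4.7.** Let $K$ be a field of characteristic $0$ and let $H=(V,E)$ be a finite hypergraph ($E$ is a set of subsets of $V$, none properly contained in another) with $n=|V|\ge 3$ vertices. Let $A=K[x_v : v\in V]$, let $I_H\subset A$ be the ideal generated by the monomials $\prod_{v\in e}x_v$, $e\in E$, and let $R=A/I_H$. For $i\ge 0$ and $b\in\mathbb Z^V$ let $b_{i,b}(H)$ be the multigraded Betti number of $R$, that is, the exponent of $A(-b)$ in the $i$-th module of the $\mathbb Z^V$-graded minimal free resolution of $R$ over $A$; write $|b|=\sum_{v}b_v$. For $v\in V$ the card $H-v$ is the hypergraph on $V\setminus\{v\}$ whose edges are the edges of $H$ not containing $v$. Then the multigraded Betti numbers $b_{i,b}(H)$ with $|b|<n$ are reconstructible from the cards, in the following two senses. 1. (Labelled cards.) Let $b\in\mathbb Z^V$ with $|b|<n$ and let $i\ge 0$. For every $v\in V$ with $b_v=0$, $$b_{i,b}(H)=b_{i,\,b|_{V\setminus\{v\}}}(H-v),$$ and if $b_v\neq 0$ for all $v\in V$, then $b_{i,b}(H)=0$. 2. (Cards up to isomorphism.) Let $H'$ be a finite hypergraph on a vertex set $V'$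 with the same deck as $H$, i.e. there is a bijection $\sigma:V\to V'$ such that $H-v\cong H'-\sigma(v)$ for all $v\in V$. Then for every integer $j<n$ and every sequence $(\beta_i)_{i\ge 0}$ of non-negative integers that is not identically zero, the number of $b\in\mathbb Z^V$ with $|b|=j$ and $b_{i,b}(H)=\beta_i$ for all $i$ equals the number of $b\in\mathbb Z^{V'}$ with $|b|=j$ and $b_{i,b}(H')=\beta_i$ for all $i$. -/

import Mathlib

universe u v

namespace HypergraphReconstruction

/-- A hypergraph on the vertex set `V`: a set of subsets of `V`, the edges, no one of which is
properly contained in another. -/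
@[ext]
structure SimpleHypergraph (V : Type u) where
  edges : Set (Finset V)
  edge_eq_of_subset : ∀ e₁ ∈ edges, ∀ e₂ ∈ edges, e₁ ⊆ e₂ → e₁ = e₂

namespace SimpleHypergraph

/-- The card `H - x`: the subhypergraph of `H` induced on the vertex set `V \ {x}`; its edges are
the edges of `H` that do not contain `x`. -/
def deleteVertex {V : Type u} (H : SimpleHypergraph V) (x : V) :
    SimpleHypergraph {w : V // w ≠ x} where
  edges := {e | e.map (Function.Embedding.subtype _) ∈ H.edges}
  edge_eq_of_subset _ h₁ _ h₂ h :=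
    Finset.map_injective _ (H.edge_eq_of_subset _ h₁ _ h₂ (Finset.map_subset_map.2 h))

/-- Isomorphism of hypergraphs: a bijection between the vertex sets that carries the edges of the
one exactly to the edges of the other. -/
def IsIsomorphic {V : Type u} {V' : Type v} (H : SimpleHypergraph V) (H' : SimpleHypergraph V') :
    Prop :=
  ∃ f : V ≃ V', ∀ e : Finset V, e.map f.toEmbedding ∈ H'.edges ↔ e ∈ H.edges

/-- Two hypergraphs have the same deck: the collections of their cards agree up to isomorphism of
the cards (with multiplicity). -/
def SameDeck {V : Type u} {V' : Type v} (H : SimpleHypergraph V) (H' : SimpleHypergraph V') :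
    Prop :=
  ∃ σ : V ≃ V', ∀ x : V, IsIsomorphic (H.deleteVertex x) (H'.deleteVertex (σ x))

/-- The edge ideal `I_H` in `K[x_v : v ∈ V]`, generated by the squarefree monomials
`∏_{x ∈ e} x` for the edges `e`; it is the Stanley-Reisner ideal of the independent complex. -/
noncomputable def edgeIdeal (K : Type v) [Field K] {V : Type u} (H : SimpleHypergraph V) :
    Ideal (MvPolynomial V K) :=
  Ideal.span ((fun e : Finset V => ∏ x ∈ e, MvPolynomial.X x) '' H.edges)

end SimpleHypergraph

/-- The polynomial `p` is homogeneous of multidegree `b ∈ ℤ^V` (zero is, for every `b`). -/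
def IsMultihomogeneous {K : Type v} [Field K] {V : Type u} (p : MvPolynomial V K) (b : V → ℤ) :
    Prop :=
  ∀ m ∈ p.support, ∀ x : V, (m x : ℤ) = b x

/-- A `ℤ^V`-graded minimal free resolution
`⋯ → F₂ → F₁ → F₀ → A/I → 0` of the `A`-module `A/I`, where `A = K[x_v : v ∈ V]`.
`F i` is the free module on the finite set `ι i`, and the basis element `a` has multidegree
`deg i a`, that is, `F i = ⨁_a A(-deg i a)`. -/
structure MinimalResolution {K : Type v} [Field K] {V : Type u} (I : Ideal (MvPolynomial V K)) where
  ι : ℕ → Type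
  finite_ι : ∀ i, Finite (ι i)
  deg : ∀ i, ι i → V → ℤ
  /-- the differentials `F (i+1) → F i` -/
  d : ∀ i, (ι (i + 1) →₀ MvPolynomial V K) →ₗ[MvPolynomial V K] (ι i →₀ MvPolynomial V K)
  /-- the augmentation `F 0 → A/I` -/
  aug : (ι 0 →₀ MvPolynomial V K) →ₗ[MvPolynomial V K] (MvPolynomial V K ⧸ I)
  /-- the differentials have multidegree zero -/
  d_graded : ∀ i (a : ι (i + 1)) (c : ι i),
    IsMultihomogeneous (d i (Finsupp.single a 1) c) (deg (i + 1) a - deg i c)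
  /-- the augmentation has multidegree zero -/
  aug_graded : ∀ a : ι 0, ∃ p : MvPolynomial V K, IsMultihomogeneous p (deg 0 a) ∧
    aug (Finsupp.single a 1) = Ideal.Quotient.mk I p
  aug_surjective : Function.Surjective aug
  exact_zero : Function.Exact (d 0) aug
  exact_succ : ∀ i, Function.Exact (d (i + 1)) (d i)
  /-- minimality: the image of every differential `F (i+1) → F i` lies in `𝔪 F i`, where `𝔪` is
  the ideal generated by the variables -/
  minimal : ∀ i (f : ι (i + 1) →₀ MvPolynomial V K) (c : ι i),
    MvPolynomial.constantCoeff (d i f c) = 0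

namespace MinimalResolution

/-- The number of basis elements of `F i` of multidegree `b`, that is, the exponent of `A(-b)` in
`F i`. -/
noncomputable def rank {K : Type v} [Field K] {V : Type u} {I : Ideal (MvPolynomial V K)}
    (F : MinimalResolution I) (i : ℕ) (b : V → ℤ) : ℕ :=
  Nat.card {a : F.ι i // F.deg i a = b}

end MinimalResolution

section Existence

variable {K : Type v} [Field K] {V : Type u}

theorem IsMultihomogeneous.zero (b : V → ℤ) : IsMultihomogeneous (0 : MvPolynomial V K) b := by
  intro m hm
  simp at hm

open Classical in
/-- The part of multidegree `b` of a polynomial. -/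
noncomputable def part (b : V → ℤ) : MvPolynomial V K →ₗ[K] MvPolynomial V K :=
  MvPolynomial.weightedHomogeneousComponent (fun x : V => (Pi.single x 1 : V → ℤ)) b

open Classical in
theorem weight_eq (m : V →₀ ℕ) :
    Finsupp.weight (fun x : V => (Pi.single x 1 : V → ℤ)) m = fun x => (m x : ℤ) := by
  funext y
  rw [Finsupp.weight_apply, Finsupp.sum, Finset.sum_apply]
  simp only [Pi.smul_apply, Pi.single_apply, nsmul_eq_mul, mul_ite, mul_one, mul_zero]
  rw [Finset.sum_ite_eq]
  split_ifs with h
  · rfl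
  · simp [Finsupp.notMem_support_iff.1 h]

open Classical in
theorem coeff_part (b : V → ℤ) (p : MvPolynomial V K) (m : V →₀ ℕ) :
    (part b p).coeff m = if (fun x => (m x : ℤ)) = b then p.coeff m else 0 := by
  rw [part, MvPolynomial.coeff_weightedHomogeneousComponent, weight_eq]

open Classical in
theorem isMultihomogeneous_iff (p : MvPolynomial V K) (b : V → ℤ) :
    IsMultihomogeneous p b ↔
      p ∈ MvPolynomial.weightedHomogeneousSubmodule K (fun x : V => (Pi.single x 1 : V → ℤ)) b := by
  rw [MvPolynomial.mem_weightedHomogeneousSubmodule]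
  constructor
  · intro h m hm
    rw [weight_eq]
    exact funext (h m (MvPolynomial.mem_support_iff.2 hm))
  · intro h m hm x
    have := h (MvPolynomial.mem_support_iff.1 hm)
    rw [weight_eq] at this
    exact congrFun this x

theorem part_isMultihomogeneous (b : V → ℤ) (p : MvPolynomial V K) :
    IsMultihomogeneous (part b p) b := by
  intro m hm x
  rw [MvPolynomial.mem_support_iff, coeff_part] at hm
  split_ifs at hm with h
  · exact congrFun h x
  · exact absurd rfl hm

theorem part_mul {b c : V → ℤ} (p q : MvPolynomial V K) (hq : IsMultihomogeneous q c) :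
    part (b + c) (p * q) = part b p * q := by
  classical
  rw [isMultihomogeneous_iff] at hq
  let := MvPolynomial.weightedGradedAlgebra K (fun x : V => (Pi.single x 1 : V → ℤ))
  have h := DirectSum.coe_decompose_mul_add_of_right_mem
    (MvPolynomial.weightedHomogeneousSubmodule K (fun x : V => (Pi.single x 1 : V → ℤ)))
    (a := p) (i := b) hq
  erw [MvPolynomial.weightedDecomposition.decompose'_apply,
    MvPolynomial.weightedDecomposition.decompose'_apply] at h
  exact h

/-- An element of the graded free module with basis degrees `D` is homogeneous of degree `b`. -/
def IsHom {κ : Type} (D : κ → V → ℤ) (f : κ →₀ MvPolynomial V K) (b : V → ℤ) : Prop :=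
  ∀ k, IsMultihomogeneous (f k) (b - D k)

/-- A submodule of a graded free module that is generated by homogeneous elements. -/
def IsGraded {κ : Type} (D : κ → V → ℤ)
    (N : Submodule (MvPolynomial V K) (κ →₀ MvPolynomial V K)) : Prop :=
  N = Submodule.span _ {f | f ∈ N ∧ ∃ b, IsHom D f b}

/-- The component of degree `b` of an element of a graded free module. -/
noncomputable def comp {κ : Type} [Finite κ] (D : κ → V → ℤ) (b : V → ℤ)
    (f : κ →₀ MvPolynomial V K) : κ →₀ MvPolynomial V K :=
  Finsupp.equivFunOnFinite.symm fun k => part (b - D k) (f k)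

theorem exists_sum_comp {κ : Type} [Finite κ] (D : κ → V → ℤ) (f : κ →₀ MvPolynomial V K) :
    ∃ S : Finset (V → ℤ), f = ∑ b ∈ S, comp D b f := by
  classical
  refine ⟨f.support.biUnion fun k => (f k).support.image fun m => (fun x => (m x : ℤ)) + D k, ?_⟩
  ext k m
  rw [Finsupp.finsetSum_apply, MvPolynomial.coeff_sum]
  have key : ∀ b : V → ℤ, (comp D b f k).coeff m =
      if (fun x => (m x : ℤ)) + D k = b then (f k).coeff m else 0 := by
    intro b
    change (part (b - D k) (f k)).coeff m = _
    rw [coeff_part]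
    simp only [eq_sub_iff_add_eq]
  simp only [key]
  rw [Finset.sum_ite_eq]
  split_ifs with h
  · rfl
  · by_contra hne
    apply h
    simp only [Finset.mem_biUnion, Finset.mem_image]
    refine ⟨k, ?_, m, MvPolynomial.mem_support_iff.2 hne, rfl⟩
    rw [Finsupp.mem_support_iff]
    intro h0
    rw [h0] at hne
    simp at hne

theorem linearCombination_comp {κ κ' : Type} [Finite κ'] (D : κ → V → ℤ) (D' : κ' → V → ℤ)
    (g : κ' → κ →₀ MvPolynomial V K) (hg : ∀ j, IsHom D (g j) (D' j)) (b : V → ℤ)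
    (z : κ' →₀ MvPolynomial V K) (hz : Finsupp.linearCombination (MvPolynomial V K) g z = 0) :
    Finsupp.linearCombination (MvPolynomial V K) g (comp D' b z) = 0 := by
  have := Fintype.ofFinite κ'
  rw [Finsupp.linearCombination_apply, Finsupp.sum_fintype _ _ (by simp)] at hz ⊢
  ext1 k
  have h := congrArg (fun f : κ →₀ MvPolynomial V K => part (b - D k) (f k)) hz
  simp only [Finsupp.finsetSum_apply, Finsupp.smul_apply, smul_eq_mul, map_sum, Finsupp.zero_apply,
    map_zero] at h ⊢
  rw [← h]
  refine Finset.sum_congr rfl fun j _ => ?_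
  rw [show b - D k = (b - D' j) + (D' j - D k) by abel, part_mul _ _ (hg j k)]
  rfl

theorem isGraded_ker {κ κ' : Type} [Finite κ'] (D : κ → V → ℤ) (D' : κ' → V → ℤ)
    (g : κ' → κ →₀ MvPolynomial V K) (hg : ∀ j, IsHom D (g j) (D' j)) :
    IsGraded D' (LinearMap.ker (Finsupp.linearCombination (MvPolynomial V K) g)) := by
  apply le_antisymm
  · intro z hz
    obtain ⟨S, hS⟩ := exists_sum_comp D' z
    rw [hS]
    refine Submodule.sum_mem _ fun b _ => Submodule.subset_span ⟨?_, b, ?_⟩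
    · exact linearCombination_comp D D' g hg b z hz
    · exact fun k => part_isMultihomogeneous _ _
  · exact Submodule.span_le.2 fun f hf => hf.1

/-- A graded submodule has a minimal system of homogeneous generators. -/
theorem exists_cover [Finite V] {κ : Type} [Finite κ] (D : κ → V → ℤ)
    (N : Submodule (MvPolynomial V K) (κ →₀ MvPolynomial V K)) (hN : IsGraded D N) :
    ∃ (n : ℕ) (g : Fin n → κ →₀ MvPolynomial V K) (D' : Fin n → V → ℤ),
      (∀ j, IsHom D (g j) (D' j)) ∧
      LinearMap.range (Finsupp.linearCombination (MvPolynomial V K) g) = N ∧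
      ∀ z ∈ LinearMap.ker (Finsupp.linearCombination (MvPolynomial V K) g), ∀ j,
        MvPolynomial.constantCoeff (z j) = 0 := by
  classical
  let P : ℕ → Prop := fun n => ∃ (g : Fin n → κ →₀ MvPolynomial V K) (D' : Fin n → V → ℤ),
      (∀ j, IsHom D (g j) (D' j)) ∧ Submodule.span (MvPolynomial V K) (Set.range g) = N
  have hP : ∃ n, P n := by
    have hfg : N.FG := IsNoetherian.noetherian N
    rw [hN, Submodule.fg_span_iff_fg_span_finset_subset] at hfg
    obtain ⟨s, hs, hsp⟩ := hfg
    have hs' : ∀ x : s, ∃ b, IsHom D (x : κ →₀ MvPolynomial V K) b := fun x => (hs x.2).2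
    choose δ hδ using hs'
    refine ⟨s.card, fun j => (s.equivFin.symm j : κ →₀ MvPolynomial V K),
      fun j => δ (s.equivFin.symm j), fun j => hδ _, ?_⟩
    rw [hN, hsp]
    congr 1
    ext x
    constructor
    · rintro ⟨j, rfl⟩
      exact (s.equivFin.symm j).2
    · intro hx
      exact ⟨s.equivFin ⟨x, hx⟩, by simp⟩
  obtain ⟨g, D', hg, hspan⟩ := Nat.find_spec hP
  have hmin : ∀ m, m < Nat.find hP → ¬ P m := fun m hm => Nat.find_min hP hm
  revert g D' hmin
  generalize Nat.find hP = n
  intro g D' hg hspan hmin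
  refine ⟨n, g, D', hg, by rw [Finsupp.range_linearCombination, hspan], ?_⟩
  intro z hz j
  by_contra hne
  cases n with
  | zero => exact j.elim0
  | succ n =>
    apply hmin n (Nat.lt_succ_self n)
    refine ⟨fun k => g (j.succAbove k), fun k => D' (j.succAbove k), fun k => hg _, ?_⟩
    have h0 := linearCombination_comp D D' g hg (D' j) z hz
    have hc : comp D' (D' j) z j = MvPolynomial.C (MvPolynomial.constantCoeff (z j)) := by
      change part (D' j - D' j) (z j) = _
      ext m
      rw [coeff_part, sub_self, MvPolynomial.coeff_C]
      by_cases hm : m = 0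
      · subst hm
        rw [if_pos (by funext x; simp), if_pos rfl]
        rfl
      · rw [if_neg, if_neg (Ne.symm hm)]
        intro h
        apply hm
        ext x
        have := congrFun h x
        simpa using this
    have hmem : g j ∈ Submodule.span (MvPolynomial V K)
        (Set.range fun k => g (j.succAbove k)) := by
      rw [Finsupp.linearCombination_apply, Finsupp.sum_fintype _ _ (by simp),
        Fin.sum_univ_succAbove _ j, hc] at h0
      have h1 : (MvPolynomial.C (MvPolynomial.constantCoeff (z j)) : MvPolynomial V K) • g j ∈
          Submodule.span (MvPolynomial V K) (Set.range fun k => g (j.succAbove k)) := by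
        rw [eq_neg_of_add_eq_zero_left h0]
        exact Submodule.neg_mem _ (Submodule.sum_mem _ fun k _ =>
          Submodule.smul_mem _ _ (Submodule.subset_span ⟨k, rfl⟩))
      have h2 := Submodule.smul_mem _
        (MvPolynomial.C (MvPolynomial.constantCoeff (z j))⁻¹ : MvPolynomial V K) h1
      rwa [smul_smul, ← map_mul, inv_mul_cancel₀ hne, map_one, one_smul] at h2
    rw [← hspan]
    apply le_antisymm
    · apply Submodule.span_mono
      rintro _ ⟨k, rfl⟩
      exact ⟨_, rfl⟩
    · rw [Submodule.span_le]
      rintro _ ⟨k, rfl⟩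
      rcases Fin.eq_self_or_eq_succAbove j k with rfl | ⟨k, rfl⟩
      · exact hmem
      · exact Submodule.subset_span ⟨k, rfl⟩

/-- A graded submodule of `𝔪 F` for a finite graded free module `F`. -/
structure Stage (K : Type v) [Field K] (V : Type u) where
  κ : Type
  finite_κ : Finite κ
  D : κ → V → ℤ
  N : Submodule (MvPolynomial V K) (κ →₀ MvPolynomial V K)
  graded : IsGraded D N
  minimal : ∀ f ∈ N, ∀ k, MvPolynomial.constantCoeff (f k) = 0

theorem Stage.exists_next [Finite V] (s : Stage K V) :
    ∃ (t : Stage K V) (g : t.κ → s.κ →₀ MvPolynomial V K),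
      (∀ j, IsHom s.D (g j) (t.D j)) ∧
      LinearMap.range (Finsupp.linearCombination (MvPolynomial V K) g) = s.N ∧
      LinearMap.ker (Finsupp.linearCombination (MvPolynomial V K) g) = t.N := by
  have := s.finite_κ
  obtain ⟨n, g, D', hg, hr, hm⟩ := exists_cover s.D s.N s.graded
  exact ⟨⟨Fin n, inferInstance, D', _, isGraded_ker s.D D' g hg, hm⟩, g, hg, hr, rfl⟩

/-- A homogeneous presentation `F 0 → A/I` whose kernel is a graded submodule of `𝔪 F 0` extends
to a graded minimal free resolution. -/
theorem nonempty_of_stage [Finite V] {I : Ideal (MvPolynomial V K)} (s : Stage K V)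
    (aug : (s.κ →₀ MvPolynomial V K) →ₗ[MvPolynomial V K] (MvPolynomial V K ⧸ I))
    (hgr : ∀ a, ∃ p : MvPolynomial V K, IsMultihomogeneous p (s.D a) ∧
      aug (Finsupp.single a 1) = Ideal.Quotient.mk I p)
    (hsurj : Function.Surjective aug) (hker : LinearMap.ker aug = s.N) :
    Nonempty (MinimalResolution I) := by
  choose nxt g hg hr hk using fun s : Stage K V => s.exists_next
  let seq : ℕ → Stage K V := fun i => Nat.rec s (fun _ t => nxt t) i
  refine ⟨{
    ι := fun i => (seq i).κ
    finite_ι := fun i => (seq i).finite_κ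
    deg := fun i => (seq i).D
    d := fun i => Finsupp.linearCombination (MvPolynomial V K) (g (seq i))
    aug := aug
    d_graded := ?_
    aug_graded := hgr
    aug_surjective := hsurj
    exact_zero := ?_
    exact_succ := ?_
    minimal := ?_ }⟩
  · intro i a c
    have h := hg (seq i) a c
    change IsMultihomogeneous (Finsupp.linearCombination (MvPolynomial V K) (g (seq i))
      (Finsupp.single a 1) c) _
    rw [Finsupp.linearCombination_single, one_smul]
    exact h
  · rw [LinearMap.exact_iff, hker]
    exact (hr s).symm
  · intro i
    rw [LinearMap.exact_iff]
    exact (hk (seq i)).trans (hr (seq (i + 1))).symm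
  · intro i f c
    refine (seq i).minimal _ ?_ c
    rw [← hr (seq i)]
    exact ⟨f, rfl⟩

theorem isMultihomogeneous_prod_X (e : Finset V) :
    ∃ b, IsMultihomogeneous (∏ x ∈ e, (MvPolynomial.X x : MvPolynomial V K)) b := by
  classical
  simp only [isMultihomogeneous_iff, MvPolynomial.mem_weightedHomogeneousSubmodule]
  exact ⟨_, MvPolynomial.IsWeightedHomogeneous.prod e _ _
    fun x _ => MvPolynomial.isWeightedHomogeneous_X K _ x⟩

/-- The Stanley-Reisner ring of a finite hypergraph has a multigraded minimal free resolution. -/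
theorem nonempty_minimalResolution [Finite V] (H : SimpleHypergraph V) :
    Nonempty (MinimalResolution (H.edgeIdeal K)) := by
  classical
  by_cases h0 : (∅ : Finset V) ∈ H.edges
  · have htop : H.edgeIdeal K = ⊤ := by
      rw [Ideal.eq_top_iff_one]
      exact Ideal.subset_span ⟨∅, h0, by simp⟩
    have hs : Subsingleton (MvPolynomial V K ⧸ H.edgeIdeal K) :=
      Ideal.Quotient.subsingleton_iff.2 htop
    refine nonempty_of_stage (I := H.edgeIdeal K)
      ⟨Empty, inferInstance, fun a => a.elim, ⊥, ?_, fun _ _ k => k.elim⟩ 0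
      (fun a => a.elim) (fun y => ⟨0, Subsingleton.elim _ _⟩) (Subsingleton.elim _ _)
    exact Subsingleton.elim _ _
  · let aug : (Unit →₀ MvPolynomial V K) →ₗ[MvPolynomial V K] (MvPolynomial V K ⧸ H.edgeIdeal K) :=
      (Submodule.mkQ (H.edgeIdeal K)).comp (Finsupp.lapply ())
    have hmem : ∀ f : Unit →₀ MvPolynomial V K, f ∈ LinearMap.ker aug ↔ f () ∈ H.edgeIdeal K := by
      intro f
      rw [LinearMap.mem_ker]
      exact Submodule.Quotient.mk_eq_zero _
    refine nonempty_of_stage (I := H.edgeIdeal K)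
      ⟨Unit, inferInstance, fun _ => 0, LinearMap.ker aug, ?_, ?_⟩ aug ?_ ?_ rfl
    · apply le_antisymm
      · intro f hf
        rw [hmem] at hf
        have hf' : f = Finsupp.lsingle (R := MvPolynomial V K) () (f ()) := by
          refine Finsupp.ext fun a => ?_
          simp
        rw [hf']
        have hle : H.edgeIdeal K ≤ Submodule.comap
            (Finsupp.lsingle (R := MvPolynomial V K) (M := MvPolynomial V K) ())
            (Submodule.span (MvPolynomial V K)
              {f | f ∈ LinearMap.ker aug ∧ ∃ b, IsHom (fun _ : Unit => (0 : V → ℤ)) f b}) := by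
          refine Submodule.span_le.2 ?_
          rintro _ ⟨e, he, rfl⟩
          refine Submodule.subset_span ⟨?_, ?_⟩
          · rw [hmem]
            simp only [Finsupp.lsingle_apply, Finsupp.single_eq_same]
            exact Ideal.subset_span ⟨e, he, rfl⟩
          · obtain ⟨b, hb⟩ := isMultihomogeneous_prod_X (K := K) e
            refine ⟨b, fun k => ?_⟩
            simpa using hb
        exact hle hf
      · exact Submodule.span_le.2 fun f hf => hf.1
    · intro f hf k
      rw [hmem] at hf
      have hle : H.edgeIdeal K ≤ RingHom.ker (MvPolynomial.constantCoeff (R := K) (σ := V)) := by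
        refine Ideal.span_le.2 ?_
        rintro _ ⟨e, he, rfl⟩
        have hne : e.Nonempty := by
          rw [Finset.nonempty_iff_ne_empty]
          rintro rfl
          exact h0 he
        obtain ⟨x, hx⟩ := hne
        change MvPolynomial.constantCoeff (∏ x ∈ e, MvPolynomial.X x) = 0
        rw [map_prod]
        exact Finset.prod_eq_zero hx (MvPolynomial.constantCoeff_X K x)
      exact hle hf
    · intro a
      refine ⟨1, ?_, ?_⟩
      · intro m hm x
        rw [MvPolynomial.mem_support_iff, MvPolynomial.coeff_one] at hm
        split_ifs at hm with h
        · subst h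
          simp
        · exact absurd rfl hm
      · change Submodule.mkQ _ (Finsupp.single a 1 ()) = _
        rw [Finsupp.single_eq_same]
        rfl
    · intro y
      obtain ⟨p, rfl⟩ := Submodule.mkQ_surjective _ y
      refine ⟨Finsupp.single () p, ?_⟩
      change Submodule.mkQ _ (Finsupp.single () p ()) = _
      rw [Finsupp.single_eq_same]

end Existence

/-- The multigraded Betti number `b_{i,b}` of `R = A/I_H`: the exponent of `A(-b)` in the `i`-th
module of the multigraded minimal free resolution of `R`. -/
noncomputable def multigradedBetti (K : Type v) [Field K] {V : Type u} [Finite V]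
    (H : SimpleHypergraph V) (i : ℕ) (b : V → ℤ) : ℕ :=
  (Classical.choice (nonempty_minimalResolution (K := K) H)).rank i b

end HypergraphReconstruction

universe w

/-!
Two multigraded minimal resolutions of `A/I` are joined by comparison maps in both directions; the
composites are homotopic to the identity, hence equal to it modulo the variables, so the ranks agree
in every multidegree and `b_{i,b}` may be computed from any minimal resolution. Keeping only the
basis elements of a minimal resolution of `A/I_H` whose degree vanishes at `v`, and setting `x_v` to
zero in the differentials, leaves a minimal resolution for `H - v` over the remaining variables:
this is the labelled part, since degrees of basis elements are non-negative and a non-negative `b`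
with `|b| < n` has a zero.

For the unlabelled part, weight every pair of a vector `b` with the given Betti numbers and a zero
`v` of `b` by the inverse of the number of zeros of `b`. The total weight is the number of such
vectors, and the contribution of `v` depends only on the card `H - v` up to isomorphism.
-/

namespace HypergraphReconstruction

open MvPolynomial
open Finsupp (single)

section GradedMaps

variable {K : Type v} [Field K] {V : Type u}

theorem IsMultihomogeneous.eq_zero_of_neg {p : MvPolynomial V K} {b : V → ℤ}
    (hp : IsMultihomogeneous p b) {x : V} (hx : b x < 0) : p = 0 := by
  by_contra hne
  obtain ⟨m, hm⟩ := support_nonempty.2 hne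
  have := hp m hm x
  omega

theorem IsMultihomogeneous.constantCoeff_eq_zero {p : MvPolynomial V K} {b : V → ℤ}
    (hp : IsMultihomogeneous p b) (hb : b ≠ 0) : constantCoeff p = 0 := by
  by_contra hne
  refine hb (funext fun x => ?_)
  simpa using (hp 0 (mem_support_iff.2 hne) x).symm

theorem IsMultihomogeneous.part_eq {p : MvPolynomial V K} {b : V → ℤ}
    (hp : IsMultihomogeneous p b) : part b p = p := by
  classical
  ext m
  rw [coeff_part, ite_eq_left_iff]
  intro hm
  by_contra hne
  exact hm (funext (hp m (mem_support_iff.2 (Ne.symm hne))))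

theorem IsHom.comp_eq {κ : Type} [Finite κ] {D : κ → V → ℤ} {f : κ →₀ MvPolynomial V K}
    {b : V → ℤ} (hf : IsHom D f b) : comp D b f = f :=
  Finsupp.ext fun k => (hf k).part_eq

theorem isHom_comp {κ : Type} [Finite κ] (D : κ → V → ℤ) (f : κ →₀ MvPolynomial V K)
    (b : V → ℤ) : IsHom D (comp D b f) b :=
  fun _ => part_isMultihomogeneous _ _

theorem linearMap_eq_sum_smul {R M κ : Type*} [Semiring R] [AddCommMonoid M] [Module R M]
    [Fintype κ] (φ : (κ →₀ R) →ₗ[R] M) (z : κ →₀ R) : φ z = ∑ a, z a • φ (single a 1) := by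
  conv_lhs => rw [← z.univ_sum_single, map_sum]
  refine Finset.sum_congr rfl fun a _ => ?_
  rw [← map_smul, Finsupp.smul_single_one]

theorem exists_lift_of_range_le {R P M N : Type*} [Ring R] [AddCommGroup P] [Module R P]
    [Module.Projective R P] [AddCommGroup M] [Module R M] [AddCommGroup N] [Module R N]
    (e : P →ₗ[R] N) (d : M →ₗ[R] N) (h : LinearMap.range e ≤ LinearMap.range d) :
    ∃ φ : P →ₗ[R] M, d ∘ₗ φ = e := by
  obtain ⟨φ, hφ⟩ := Module.projective_lifting_property d.rangeRestrict
    (e.codRestrict (LinearMap.range d) fun p => h ⟨p, rfl⟩) d.surjective_rangeRestrict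
  exact ⟨φ, LinearMap.ext fun p => congrArg Subtype.val (LinearMap.congr_fun hφ p)⟩

/-- The linear map `φ` between the graded free modules with basis degrees `D'` and `D` has
multidegree zero. -/
def IsGradedMap {κ' κ : Type} (D' : κ' → V → ℤ) (D : κ → V → ℤ)
    (φ : (κ' →₀ MvPolynomial V K) →ₗ[MvPolynomial V K] (κ →₀ MvPolynomial V K)) : Prop :=
  ∀ a, IsHom D (φ (single a 1)) (D' a)

namespace IsGradedMap

variable {κ₁ κ₂ κ₃ : Type} [Finite κ₂] {D₁ : κ₁ → V → ℤ} {D₂ : κ₂ → V → ℤ}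
  {D₃ : κ₃ → V → ℤ}
  {φ : (κ₁ →₀ MvPolynomial V K) →ₗ[MvPolynomial V K] (κ₂ →₀ MvPolynomial V K)}

theorem map_comp [Finite κ₁] (hφ : IsGradedMap D₁ D₂ φ) (b : V → ℤ) (z : κ₁ →₀ MvPolynomial V K) :
    φ (comp D₁ b z) = comp D₂ b (φ z) := by
  have := Fintype.ofFinite κ₁
  ext1 k
  change _ = part (b - D₂ k) (φ z k)
  rw [linearMap_eq_sum_smul φ z, linearMap_eq_sum_smul φ (comp D₁ b z)]
  simp only [Finsupp.finsetSum_apply, Finsupp.smul_apply, smul_eq_mul, map_sum]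
  refine Finset.sum_congr rfl fun a _ => ?_
  rw [show b - D₂ k = (b - D₁ a) + (D₁ a - D₂ k) by abel, part_mul _ _ (hφ a k)]
  rfl

theorem isHom [Finite κ₁] (hφ : IsGradedMap D₁ D₂ φ) {b : V → ℤ} {z : κ₁ →₀ MvPolynomial V K}
    (hz : IsHom D₁ z b) : IsHom D₂ (φ z) b := by
  rw [← hz.comp_eq, hφ.map_comp]
  exact isHom_comp _ _ _

theorem linearMap_comp [Finite κ₃]
    {ψ : (κ₂ →₀ MvPolynomial V K) →ₗ[MvPolynomial V K] (κ₃ →₀ MvPolynomial V K)}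
    (hψ : IsGradedMap D₂ D₃ ψ) (hφ : IsGradedMap D₁ D₂ φ) : IsGradedMap D₁ D₃ (ψ ∘ₗ φ) :=
  fun a => hψ.isHom (hφ a)

end IsGradedMap

theorem exists_isGradedMap_lift {κ₁ κ₂ : Type} [Finite κ₂] {D₁ : κ₁ → V → ℤ} {D₂ : κ₂ → V → ℤ}
    {N : Type*} [AddCommGroup N] [Module (MvPolynomial V K) N]
    {e : (κ₁ →₀ MvPolynomial V K) →ₗ[MvPolynomial V K] N}
    {d : (κ₂ →₀ MvPolynomial V K) →ₗ[MvPolynomial V K] N}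
    (hrange : LinearMap.range e ≤ LinearMap.range d)
    (hcomp : ∀ a z, d z = e (single a 1) → d (comp D₂ (D₁ a) z) = e (single a 1)) :
    ∃ φ : (κ₁ →₀ MvPolynomial V K) →ₗ[MvPolynomial V K] (κ₂ →₀ MvPolynomial V K),
      IsGradedMap D₁ D₂ φ ∧ d ∘ₗ φ = e := by
  obtain ⟨φ, hφ⟩ := exists_lift_of_range_le e d hrange
  refine ⟨Finsupp.linearCombination _ fun a => comp D₂ (D₁ a) (φ (single a 1)), fun a => ?_, ?_⟩
  · rw [Finsupp.linearCombination_single, one_smul]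
    exact isHom_comp _ _ _
  · ext a
    simpa using hcomp a _ (LinearMap.congr_fun hφ (single a 1))

end GradedMaps

section MultigradedIdeal

variable {K : Type v} [Field K] {V : Type u}

/-- A multigraded ideal of the polynomial ring: it contains all the components of its elements. -/
def IsMultigraded (I : Ideal (MvPolynomial V K)) : Prop :=
  ∀ p ∈ I, ∀ b, part b p ∈ I

theorem isMultigraded_span {S : Set (MvPolynomial V K)}
    (hS : ∀ p ∈ S, ∃ b, IsMultihomogeneous p b) :
    IsMultigraded (Ideal.span S) := by
  intro p hp b
  induction hp using Submodule.closure_induction with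
  | zero => simp
  | add p q _ _ hp hq => simpa using add_mem hp hq
  | smul_mem r p hp =>
    obtain ⟨c, hc⟩ := hS p hp
    rw [smul_eq_mul, ← sub_add_cancel b c, part_mul _ _ hc]
    exact Ideal.mul_mem_left _ _ (Ideal.subset_span hp)

theorem SimpleHypergraph.isMultigraded_edgeIdeal (H : SimpleHypergraph V) :
    IsMultigraded (H.edgeIdeal K) := by
  refine isMultigraded_span ?_
  rintro _ ⟨e, -, rfl⟩
  exact isMultihomogeneous_prod_X e

end MultigradedIdeal

section Reduction

variable {K : Type v} [Field K] {V : Type u} {κ₁ κ₂ : Type*}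

/-- Reduction of a free module over the polynomial ring modulo the ideal generated by the
variables. -/
noncomputable def reduce :
    (κ₁ →₀ MvPolynomial V K) →ₛₗ[(constantCoeff : MvPolynomial V K →+* K)] (κ₁ →₀ K) :=
  Finsupp.mapRange.linearMap (constantCoeff : MvPolynomial V K →+* K).toSemilinearMap

@[simp]
theorem reduce_apply (f : κ₁ →₀ MvPolynomial V K) (a : κ₁) :
    reduce f a = constantCoeff (f a) :=
  rfl

theorem reduce_surjective :
    Function.Surjective (reduce : (κ₁ →₀ MvPolynomial V K) → (κ₁ →₀ K)) := fun f =>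
  ⟨f.mapRange C (map_zero C), by ext; simp⟩

/-- The `K`-linear map induced modulo the variables by a linear map of free modules over the
polynomial ring. -/
noncomputable def residue
    (φ : (κ₁ →₀ MvPolynomial V K) →ₗ[MvPolynomial V K] (κ₂ →₀ MvPolynomial V K)) :
    (κ₁ →₀ K) →ₗ[K] (κ₂ →₀ K) :=
  Finsupp.linearCombination K fun a => reduce (φ (single a 1))

theorem residue_reduce
    (φ : (κ₁ →₀ MvPolynomial V K) →ₗ[MvPolynomial V K] (κ₂ →₀ MvPolynomial V K))
    (f : κ₁ →₀ MvPolynomial V K) : residue φ (reduce f) = reduce (φ f) := by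
  have : (residue φ).comp reduce = reduce.comp φ := by
    ext a : 2
    simp [reduce, residue]
  exact LinearMap.congr_fun this f

end Reduction

theorem IsGradedMap.card_le_of_residue_injective {K : Type v} [Field K] {V : Type u}
    {κ₁ κ₂ : Type} [Finite κ₁] [Finite κ₂] {D₁ : κ₁ → V → ℤ} {D₂ : κ₂ → V → ℤ}
    {φ : (κ₁ →₀ MvPolynomial V K) →ₗ[MvPolynomial V K] (κ₂ →₀ MvPolynomial V K)}
    (hφ : IsGradedMap D₁ D₂ φ) (hinj : Function.Injective (residue φ)) (b : V → ℤ) :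
    Nat.card {a // D₁ a = b} ≤ Nat.card {c // D₂ c = b} := by
  have := Fintype.ofFinite {a // D₁ a = b}
  have := Fintype.ofFinite {c // D₂ c = b}
  have hmem : ∀ a : {a // D₁ a = b},
      residue φ (single a.1 1) ∈ Finsupp.supported K K {c | D₂ c = b} := by
    refine fun a => (Finsupp.mem_supported' K _).2 fun c hc => ?_
    rw [residue, Finsupp.linearCombination_single, one_smul, reduce_apply]
    exact (hφ a.1 c).constantCoeff_eq_zero (by rw [a.2]; exact sub_ne_zero.2 (Ne.symm hc))
  have hind : LinearIndependent K fun a : {a // D₁ a = b} =>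
      (⟨residue φ (single a.1 1), hmem a⟩ : Finsupp.supported K K {c | D₂ c = b}) :=
    .of_comp (Submodule.subtype _) <|
      ((Finsupp.linearIndependent_single_one K κ₁).map' _ (LinearMap.ker_eq_bot.2 hinj)).comp _
        Subtype.val_injective
  have e := Finsupp.supportedEquivFinsupp (M := K) (R := K) {c | D₂ c = b}
  have := Module.Finite.equiv e.symm
  rw [Nat.card_eq_fintype_card, Nat.card_eq_fintype_card,
    ← Module.finrank_finsupp_self (R := K) (ι := {c // D₂ c = b})]
  exact hind.fintype_card_le_finrank.trans_eq e.finrank_eq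

namespace MinimalResolution

variable {K : Type v} [Field K] {V : Type u} {I : Ideal (MvPolynomial V K)}

instance (F : MinimalResolution I) (i : ℕ) : Finite (F.ι i) :=
  F.finite_ι i

theorem isGradedMap_d (F : MinimalResolution I) (i : ℕ) :
    IsGradedMap (F.deg (i + 1)) (F.deg i) (F.d i) :=
  F.d_graded i

theorem d_d (F : MinimalResolution I) (i : ℕ) (f : F.ι (i + 2) →₀ MvPolynomial V K) :
    F.d i (F.d (i + 1) f) = 0 :=
  (F.exact_succ i).apply_apply_eq_zero f

theorem aug_d (F : MinimalResolution I) (f : F.ι 1 →₀ MvPolynomial V K) :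
    F.aug (F.d 0 f) = 0 :=
  F.exact_zero.apply_apply_eq_zero f

theorem reduce_d (F : MinimalResolution I) (i : ℕ) (f : F.ι (i + 1) →₀ MvPolynomial V K) :
    reduce (F.d i f) = 0 :=
  Finsupp.ext (F.minimal i f)

theorem single_ne_d (F : MinimalResolution I) (i : ℕ) (a : F.ι i)
    (f : F.ι (i + 1) →₀ MvPolynomial V K) : F.d i f ≠ single a 1 := by
  intro h
  simpa [h] using F.minimal i f a

theorem deg_nonneg (F : MinimalResolution I) (i : ℕ) (a : F.ι i) (x : V) : 0 ≤ F.deg i a x := by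
  induction i with
  | zero =>
    by_contra! hlt
    obtain ⟨p, hp, hpa⟩ := F.aug_graded a
    rw [hp.eq_zero_of_neg hlt, map_zero] at hpa
    obtain ⟨f, hf⟩ := (F.exact_zero _).1 hpa
    exact F.single_ne_d 0 a f hf
  | succ i ih =>
    by_contra! hlt
    have hzero : F.d i (single a 1) = 0 := Finsupp.ext fun c =>
      (F.d_graded i a c).eq_zero_of_neg (x := x) (sub_neg.2 (hlt.trans_le (ih c)))
    obtain ⟨f, hf⟩ := (F.exact_succ i _).1 hzero
    exact F.single_ne_d (i + 1) a f hf

theorem rank_eq_zero_of_neg (F : MinimalResolution I) (i : ℕ) {b : V → ℤ} {x : V} (hx : b x < 0) :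
    F.rank i b = 0 := by
  have : IsEmpty {a // F.deg i a = b} := ⟨fun a => hx.not_ge (a.2 ▸ F.deg_nonneg i a.1 x)⟩
  exact Nat.card_of_isEmpty

theorem aug_comp (hI : IsMultigraded I) (F : MinimalResolution I)
    {z : F.ι 0 →₀ MvPolynomial V K} {p : MvPolynomial V K} {b : V → ℤ}
    (hz : F.aug z = Ideal.Quotient.mk I p) (hp : IsMultihomogeneous p b) :
    F.aug (comp (F.deg 0) b z) = Ideal.Quotient.mk I p := by
  have := Fintype.ofFinite (F.ι 0)
  choose q hq hqa using F.aug_graded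
  have haug : ∀ f, F.aug f = Ideal.Quotient.mk I (∑ c, f c * q c) := fun f => by
    simp only [linearMap_eq_sum_smul F.aug f, hqa, map_sum]
    rfl
  rw [haug, Ideal.Quotient.mk_eq_mk_iff_sub_mem] at hz ⊢
  convert hI _ hz b using 1
  rw [map_sub, hp.part_eq, map_sum]
  congr 1
  refine Finset.sum_congr rfl fun c _ => ?_
  conv_rhs => rw [← sub_add_cancel b (F.deg 0 c), part_mul _ _ (hq c)]
  rfl

/-- A multigraded morphism of resolutions of `A/I` that lifts the identity of `A/I`. -/
structure Comparison (F G : MinimalResolution I) where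
  map : ∀ i, (F.ι i →₀ MvPolynomial V K) →ₗ[MvPolynomial V K] (G.ι i →₀ MvPolynomial V K)
  isGradedMap : ∀ i, IsGradedMap (F.deg i) (G.deg i) (map i)
  aug_map : ∀ f, G.aug (map 0 f) = F.aug f
  d_map : ∀ i f, G.d i (map (i + 1) f) = map i (F.d i f)

theorem exists_lift_aug (hI : IsMultigraded I) (F G : MinimalResolution I) :
    ∃ φ, IsGradedMap (F.deg 0) (G.deg 0) φ ∧ G.aug ∘ₗ φ = F.aug := by
  refine exists_isGradedMap_lift ?_ fun a z hz => ?_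
  · rw [LinearMap.range_eq_top.2 G.aug_surjective]
    exact le_top
  · obtain ⟨p, hp, hpa⟩ := F.aug_graded a
    rw [hpa] at hz ⊢
    exact G.aug_comp hI hz hp

theorem exists_lift_d {F G : MinimalResolution I} {i : ℕ}
    {φ : (F.ι i →₀ MvPolynomial V K) →ₗ[MvPolynomial V K] (G.ι i →₀ MvPolynomial V K)}
    (hφ : IsGradedMap (F.deg i) (G.deg i) φ)
    (hrange : LinearMap.range (φ ∘ₗ F.d i) ≤ LinearMap.range (G.d i)) :
    ∃ φ', IsGradedMap (F.deg (i + 1)) (G.deg (i + 1)) φ' ∧ G.d i ∘ₗ φ' = φ ∘ₗ F.d i := by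
  refine exists_isGradedMap_lift hrange fun a z hz => ?_
  rw [(G.isGradedMap_d i).map_comp, hz]
  exact (hφ.linearMap_comp (F.isGradedMap_d i) a).comp_eq

theorem nonempty_comparison (hI : IsMultigraded I) (F G : MinimalResolution I) :
    Nonempty (Comparison F G) := by
  let Liftable (i : ℕ) := {φ : (F.ι i →₀ MvPolynomial V K) →ₗ[MvPolynomial V K]
      (G.ι i →₀ MvPolynomial V K) // IsGradedMap (F.deg i) (G.deg i) φ ∧
        LinearMap.range (φ ∘ₗ F.d i) ≤ LinearMap.range (G.d i)}
  have hnext : ∀ i (φ : Liftable i), ∃ φ' : Liftable (i + 1), G.d i ∘ₗ φ'.1 = φ.1 ∘ₗ F.d i := by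
    rintro i ⟨φ, hφ, hrange⟩
    obtain ⟨φ', hφ', hd⟩ := exists_lift_d hφ hrange
    refine ⟨⟨φ', hφ', ?_⟩, hd⟩
    rintro _ ⟨f, rfl⟩
    exact (G.exact_succ i _).1 <| (LinearMap.congr_fun hd _).trans (by simp [d_d])
  obtain ⟨φ₀, hφ₀, haug⟩ := exists_lift_aug hI F G
  have hrange : LinearMap.range (φ₀ ∘ₗ F.d 0) ≤ LinearMap.range (G.d 0) := by
    rintro _ ⟨f, rfl⟩
    exact (G.exact_zero _).1 <| (LinearMap.congr_fun haug _).trans (F.aug_d f)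
  choose next hd using hnext
  let φ (i : ℕ) : Liftable i := Nat.rec ⟨φ₀, hφ₀, hrange⟩ next i
  exact ⟨{
    map := fun i => (φ i).1
    isGradedMap := fun i => (φ i).2.1
    aug_map := LinearMap.congr_fun haug
    d_map := fun i => LinearMap.congr_fun (hd i (φ i)) }⟩

namespace Comparison

variable {F G E : MinimalResolution I}

/-- The composite of two comparison morphisms. -/
noncomputable def trans (φ : Comparison F G) (ψ : Comparison G E) : Comparison F E where
  map i := ψ.map i ∘ₗ φ.map i
  isGradedMap i := (ψ.isGradedMap i).linearMap_comp (φ.isGradedMap i)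
  aug_map f := (ψ.aug_map _).trans (φ.aug_map f)
  d_map i f := (ψ.d_map i _).trans (congrArg (ψ.map i) (φ.d_map i f))

theorem exists_homotopy_zero (θ : Comparison F F) :
    ∃ h : (F.ι 0 →₀ MvPolynomial V K) →ₗ[MvPolynomial V K] (F.ι 1 →₀ MvPolynomial V K),
      ∀ f, F.d 0 (h f) = θ.map 0 f - f := by
  obtain ⟨h, hh⟩ := exists_lift_of_range_le (θ.map 0 - LinearMap.id) (F.d 0) (by
    rintro _ ⟨f, rfl⟩
    exact (F.exact_zero _).1 (by simp [θ.aug_map]))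
  exact ⟨h, LinearMap.congr_fun hh⟩

theorem exists_homotopy_succ (θ : Comparison F F) {i : ℕ}
    {h : (F.ι i →₀ MvPolynomial V K) →ₗ[MvPolynomial V K] (F.ι (i + 1) →₀ MvPolynomial V K)}
    (hh : ∀ f, F.d i (h (F.d i f)) = θ.map i (F.d i f) - F.d i f) :
    ∃ h' : (F.ι (i + 1) →₀ MvPolynomial V K) →ₗ[MvPolynomial V K]
        (F.ι (i + 2) →₀ MvPolynomial V K),
      ∀ f, F.d (i + 1) (h' f) = θ.map (i + 1) f - f - h (F.d i f) := by
  obtain ⟨h', hh'⟩ := exists_lift_of_range_le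
    (θ.map (i + 1) - LinearMap.id - h ∘ₗ F.d i) (F.d (i + 1)) (by
      rintro _ ⟨f, rfl⟩
      exact (F.exact_succ i _).1 (by simp [θ.d_map, hh]))
  exact ⟨h', LinearMap.congr_fun hh'⟩

theorem exists_homotopy (θ : Comparison F F) (i : ℕ) :
    ∃ h : (F.ι i →₀ MvPolynomial V K) →ₗ[MvPolynomial V K] (F.ι (i + 1) →₀ MvPolynomial V K),
      ∀ f, F.d i (h (F.d i f)) = θ.map i (F.d i f) - F.d i f := by
  induction i with
  | zero =>
    obtain ⟨h, hh⟩ := θ.exists_homotopy_zero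
    exact ⟨h, fun f => hh _⟩
  | succ i ih =>
    obtain ⟨h, hh⟩ := ih
    obtain ⟨h', hh'⟩ := θ.exists_homotopy_succ hh
    exact ⟨h', fun f => by rw [hh', F.d_d, map_zero, sub_zero]⟩

theorem reduce_map (θ : Comparison F F) (i : ℕ) (f : F.ι i →₀ MvPolynomial V K) :
    reduce (θ.map i f) = reduce f := by
  rw [← sub_eq_zero, ← map_sub]
  cases i with
  | zero =>
    obtain ⟨h, hh⟩ := θ.exists_homotopy_zero
    rw [← hh, F.reduce_d]
  | succ i =>
    obtain ⟨h, hh⟩ := θ.exists_homotopy i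
    obtain ⟨h', hh'⟩ := θ.exists_homotopy_succ hh
    rw [eq_add_of_sub_eq (hh' f).symm, map_add, F.reduce_d, ← residue_reduce, F.reduce_d,
      map_zero, add_zero]

theorem residue_map_injective (φ : Comparison F G) (ψ : Comparison G F) (i : ℕ) :
    Function.Injective (residue (φ.map i)) := by
  refine Function.LeftInverse.injective (g := residue (ψ.map i)) fun x => ?_
  obtain ⟨f, rfl⟩ := reduce_surjective (V := V) x
  rw [residue_reduce, residue_reduce]
  exact (φ.trans ψ).reduce_map i f

theorem rank_le (φ : Comparison F G) (ψ : Comparison G F) (i : ℕ) (b : V → ℤ) :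
    F.rank i b ≤ G.rank i b :=
  (φ.isGradedMap i).card_le_of_residue_injective (φ.residue_map_injective ψ i) b

end Comparison

theorem rank_eq (hI : IsMultigraded I) (F G : MinimalResolution I) (i : ℕ) (b : V → ℤ) :
    F.rank i b = G.rank i b := by
  obtain ⟨φ⟩ := nonempty_comparison hI F G
  obtain ⟨ψ⟩ := nonempty_comparison hI G F
  exact le_antisymm (φ.rank_le ψ i b) (ψ.rank_le φ i b)

end MinimalResolution

section KillCompl

variable {K : Type v} [Field K] {V : Type u} {W : Type w} {f : W → V} (hf : f.Injective)
  {p : MvPolynomial V K} {b : V → ℤ}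

theorem IsMultihomogeneous.killCompl (hp : IsMultihomogeneous p b) :
    IsMultihomogeneous (killCompl hf p) (b ∘ f) := by
  intro m hm x
  rw [mem_support_iff, coeff_killCompl] at hm
  have := hp _ (mem_support_iff.2 hm) (f x)
  rwa [Finsupp.mapDomain_apply hf] at this

theorem IsMultihomogeneous.killCompl_eq_zero (hp : IsMultihomogeneous p b)
    (hb : ¬ Function.support b ⊆ Set.range f) : MvPolynomial.killCompl hf p = 0 := by
  obtain ⟨x, hbx, hx⟩ := Set.not_subset.1 hb
  ext m
  rw [coeff_killCompl, coeff_zero]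
  by_contra hne
  refine hbx ?_
  rw [← hp _ (mem_support_iff.2 hne) x, Finsupp.mapDomain_of_notMem_range _ _ hx, Nat.cast_zero]

theorem IsMultihomogeneous.rename_killCompl (hp : IsMultihomogeneous p b)
    (hb : Function.support b ⊆ Set.range f) :
    rename f (MvPolynomial.killCompl hf p) = p := by
  have hvars : (p.vars : Set V) ⊆ Set.range f := by
    intro x hx
    obtain ⟨m, hm, hmx⟩ := (mem_vars_iff_mem_support x).1 hx
    refine hb (Function.mem_support.2 ?_)
    rw [← hp m hm x, Nat.cast_ne_zero]
    exact Finsupp.mem_support_iff.1 hmx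
  obtain ⟨q, rfl⟩ := exists_rename_eq_of_vars_subset_range p f hf hvars
  rw [killCompl_rename_app]

end KillCompl

section RestrictExtend

variable {V : Type u} {W : Type w} {f : W → V}

/-- Setting the variables outside the range of `f` to zero, as a ring homomorphism. -/
noncomputable abbrev killHom (K : Type v) [Field K] (hf : f.Injective) :
    MvPolynomial V K →+* MvPolynomial W K :=
  (killCompl hf : MvPolynomial V K →ₐ[K] MvPolynomial W K)

/-- Renaming the variables along `f`, as a ring homomorphism. -/
noncomputable abbrev renameHom (K : Type v) [Field K] (f : W → V) :
    MvPolynomial W K →+* MvPolynomial V K :=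
  (rename f : MvPolynomial W K →ₐ[K] MvPolynomial V K)

variable {K : Type v} [Field K]

instance (hf : f.Injective) : RingHomCompTriple (renameHom K f) (killHom K hf)
    (RingHom.id (MvPolynomial W K)) :=
  ⟨RingHom.ext fun p => killCompl_rename_app hf p⟩

variable {κ : Type*} (s : Set κ)

/-- Forget the coordinates outside `s` and set the variables outside the range of `f` to zero. -/
noncomputable def restrict (hf : f.Injective) :
    (κ →₀ MvPolynomial V K) →ₛₗ[killHom K hf] (s →₀ MvPolynomial W K) :=
  (Finsupp.mapRange.linearMap (killHom K hf).toSemilinearMap).comp (Finsupp.lsubtypeDomain s)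

/-- Extend by zero outside `s` and rename the variables along `f`. -/
noncomputable def extend (f : W → V) :
    (s →₀ MvPolynomial W K) →ₛₗ[renameHom K f] (κ →₀ MvPolynomial V K) :=
  (Finsupp.lmapDomain _ _ Subtype.val).comp
    (Finsupp.mapRange.linearMap (renameHom K f).toSemilinearMap)

variable {s}

@[simp]
theorem restrict_apply (hf : f.Injective) (g : κ →₀ MvPolynomial V K) (a : s) :
    restrict s hf g a = killCompl hf (g a) :=
  rfl

@[simp]
theorem extend_apply_coe (g : s →₀ MvPolynomial W K) (a : s) :
    extend s f g a = rename f (g a) :=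
  Finsupp.mapDomain_apply Subtype.val_injective _ a

theorem extend_apply_of_notMem (g : s →₀ MvPolynomial W K) {a : κ} (ha : a ∉ s) :
    extend s f g a = 0 :=
  Finsupp.mapDomain_of_notMem_range _ _ (by simpa using ha)

@[simp]
theorem restrict_extend (hf : f.Injective) (g : s →₀ MvPolynomial W K) :
    restrict s hf (extend s f g) = g := by
  ext1 a
  rw [restrict_apply, extend_apply_coe, killCompl_rename_app]

@[simp]
theorem extend_single_one (a : s) :
    extend s f (single a (1 : MvPolynomial W K)) = single a.1 (1 : MvPolynomial V K) := by
  simp [extend]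

theorem restrict_single_one_of_notMem (hf : f.Injective) {a : κ} (ha : a ∉ s) :
    restrict s hf (single a (1 : MvPolynomial V K)) = 0 := by
  ext1 c
  have hca : c.1 ≠ a := fun h => ha (h ▸ c.2)
  rw [restrict_apply, Finsupp.single_eq_of_ne hca, map_zero, Finsupp.zero_apply]

variable {N : Type*} [AddCommGroup N] [Module (MvPolynomial V K) N]
  {N' : Type*} [AddCommGroup N'] [Module (MvPolynomial W K) N']

/-- The restriction to the variables in the range of `f` and the basis elements in `s` of a linear
map into a module `N` that is restricted by `r`. -/
noncomputable def restrictMap (s : Set κ) (hf : f.Injective) (r : N →ₛₗ[killHom K hf] N')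
    (φ : (κ →₀ MvPolynomial V K) →ₗ[MvPolynomial V K] N) :
    (s →₀ MvPolynomial W K) →ₗ[MvPolynomial W K] N' :=
  r.comp (φ.comp (extend s f))

theorem restrictMap_single_one (hf : f.Injective) (r : N →ₛₗ[killHom K hf] N')
    (φ : (κ →₀ MvPolynomial V K) →ₗ[MvPolynomial V K] N) (a : s) :
    restrictMap s hf r φ (single a 1) = r (φ (single a.1 1)) := by
  simp [restrictMap]

theorem apply_extend_eq (hf : f.Injective) {r : N →ₛₗ[killHom K hf] N'}
    {e : N' →ₛₗ[renameHom K f] N} {φ : (κ →₀ MvPolynomial V K) →ₗ[MvPolynomial V K] N}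
    (h : ∀ a ∈ s, e (r (φ (single a 1))) = φ (single a 1)) (g : s →₀ MvPolynomial W K) :
    φ (extend s f g) = e (restrictMap s hf r φ g) := by
  have : φ.comp (extend s f) = e.comp (restrictMap s hf r φ) := by
    ext a : 2
    simp [restrictMap_single_one, h a.1 a.2]
  exact LinearMap.congr_fun this g

theorem restrictMap_restrict (hf : f.Injective) {r : N →ₛₗ[killHom K hf] N'}
    {φ : (κ →₀ MvPolynomial V K) →ₗ[MvPolynomial V K] N}
    (h : ∀ a ∉ s, r (φ (single a 1)) = 0) (g : κ →₀ MvPolynomial V K) :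
    restrictMap s hf r φ (restrict s hf g) = r (φ g) := by
  have : (restrictMap s hf r φ).comp (restrict s hf) = r.comp φ := by
    ext a : 2
    by_cases ha : a ∈ s
    · have hrestrict : restrict s hf (single a (1 : MvPolynomial V K)) = single ⟨a, ha⟩ 1 := by
        rw [← extend_single_one ⟨a, ha⟩ (f := f), restrict_extend]
      simp [hrestrict, restrictMap_single_one]
    · simp [restrict_single_one_of_notMem hf ha, h a ha]
  exact LinearMap.congr_fun this g

end RestrictExtend

section SupportedBasis

variable {K : Type v} [Field K] {V : Type u} {W : Type w} {f : W → V} (hf : f.Injective)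
  {κ : Type} {D : κ → V → ℤ}

/-- The basis elements whose degree vanishes outside the range of `f`. -/
def supportedBasis (f : W → V) (D : κ → V → ℤ) : Set κ :=
  {a | Function.support (D a) ⊆ Set.range f}

variable {g : κ →₀ MvPolynomial V K} {b : V → ℤ}

theorem IsHom.extend_restrict (hg : IsHom D g b) (hD : 0 ≤ D)
    (hb : Function.support b ⊆ Set.range f) :
    extend _ f (restrict (supportedBasis f D) hf g) = g := by
  ext1 a
  by_cases ha : a ∈ supportedBasis f D
  · rw [extend_apply_coe (a := ⟨a, ha⟩), restrict_apply]
    refine (hg a).rename_killCompl hf ?_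
    exact (Function.support_sub b (D a)).trans (Set.union_subset hb ha)
  · obtain ⟨x, hDx, hx⟩ := Set.not_subset.1 ha
    rw [extend_apply_of_notMem _ ha]
    refine ((hg a).eq_zero_of_neg (x := x) ?_).symm
    have hbx : b x = 0 := Function.notMem_support.1 fun h => hx (hb h)
    rw [Pi.sub_apply, hbx, zero_sub, neg_lt_zero]
    exact (hD a x).lt_of_ne' hDx

theorem IsHom.restrict_eq_zero (hg : IsHom D g b) (hb : ¬ Function.support b ⊆ Set.range f) :
    restrict (supportedBasis f D) hf g = 0 := by
  ext1 a
  refine (hg a).killCompl_eq_zero hf fun hsub => hb ?_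
  rw [← sub_add_cancel b (D a)]
  exact (Function.support_add _ _).trans (Set.union_subset hsub a.2)

end SupportedBasis

theorem exact_of_retract {A B C A' B' C' : Type*} [Zero C] [Zero C'] {f : A → B} {g : B → C}
    {f' : A' → B'} {g' : B' → C'} {rA : A → A'} {rB : B → B'} {rC : C → C'} {eB : B' → B}
    {eC : C' → C} (hexact : Function.Exact f g) (hrA : Function.Surjective rA)
    (hrB : Function.LeftInverse rB eB) (hrC : rC 0 = 0) (heC : eC 0 = 0)
    (hf : ∀ a, f' (rA a) = rB (f a)) (hg : ∀ b, g' (rB b) = rC (g b))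
    (hge : ∀ b, g (eB b) = eC (g' b)) : Function.Exact f' g' := by
  intro b
  constructor
  · intro hb
    obtain ⟨a, ha⟩ := (hexact (eB b)).1 (by rw [hge, hb, heC])
    exact ⟨rA a, by rw [hf, ha, hrB]⟩
  · rintro ⟨a, rfl⟩
    obtain ⟨a, rfl⟩ := hrA a
    rw [hf, hg, hexact.apply_apply_eq_zero, hrC]

section QuotientMaps

variable {K : Type v} [Field K] {V : Type u} {W : Type w} {I : Ideal (MvPolynomial V K)}
  {I' : Ideal (MvPolynomial W K)} {f : W → V} {hf : f.Injective}

/-- The map `K[V]/I → K[W]/I'` induced by setting the variables outside the range of `f` to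
zero. -/
noncomputable def quotientKill (hI : I ≤ I'.comap (killHom K hf)) :
    (MvPolynomial V K ⧸ I) →ₛₗ[killHom K hf] (MvPolynomial W K ⧸ I') :=
  Submodule.mapQ I I' (killHom K hf).toSemilinearMap hI

/-- The map `K[W]/I' → K[V]/I` induced by renaming the variables along `f`. -/
noncomputable def quotientRename (hI : I' ≤ I.comap (renameHom K f)) :
    (MvPolynomial W K ⧸ I') →ₛₗ[renameHom K f] (MvPolynomial V K ⧸ I) :=
  Submodule.mapQ I' I (renameHom K f).toSemilinearMap hI

@[simp]
theorem quotientKill_mk (hI : I ≤ I'.comap (killHom K hf)) (p : MvPolynomial V K) :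
    quotientKill hI (Ideal.Quotient.mk I p) = Ideal.Quotient.mk I' (killCompl hf p) :=
  rfl

@[simp]
theorem quotientRename_mk (hI : I' ≤ I.comap (renameHom K f)) (p : MvPolynomial W K) :
    quotientRename hI (Ideal.Quotient.mk I' p) = Ideal.Quotient.mk I (rename f p) :=
  rfl

theorem quotientKill_surjective (hI : I ≤ I'.comap (killHom K hf)) :
    Function.Surjective (quotientKill hI) := by
  intro y
  obtain ⟨p, rfl⟩ := Ideal.Quotient.mk_surjective y
  exact ⟨Ideal.Quotient.mk I (rename f p), by rw [quotientKill_mk, killCompl_rename_app]⟩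

end QuotientMaps

namespace MinimalResolution

variable {K : Type v} [Field K] {V : Type u} {W : Type w} {I : Ideal (MvPolynomial V K)}
  {I' : Ideal (MvPolynomial W K)} (F : MinimalResolution I) {f : W → V} (hf : f.Injective)

/-- The differential between the basis elements whose degrees vanish outside the range of `f`. -/
noncomputable def restrictedD (i : ℕ) :
    (supportedBasis f (F.deg (i + 1)) →₀ MvPolynomial W K) →ₗ[MvPolynomial W K]
      (supportedBasis f (F.deg i) →₀ MvPolynomial W K) :=
  restrictMap _ hf (restrict _ hf) (F.d i)

theorem d_extend (i : ℕ) (g : supportedBasis f (F.deg (i + 1)) →₀ MvPolynomial W K) :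
    F.d i (extend _ f g) = extend _ f (F.restrictedD hf i g) :=
  apply_extend_eq hf
    (fun a ha => (F.isGradedMap_d i a).extend_restrict hf (F.deg_nonneg i) ha) g

theorem restrictedD_restrict (i : ℕ) (g : F.ι (i + 1) →₀ MvPolynomial V K) :
    F.restrictedD hf i (restrict _ hf g) = restrict _ hf (F.d i g) :=
  restrictMap_restrict hf (fun a ha => (F.isGradedMap_d i a).restrict_eq_zero hf ha) g

variable {hf}

theorem aug_extend (hI : I ≤ I'.comap (killHom K hf)) (hI' : I' ≤ I.comap (renameHom K f))
    (g : supportedBasis f (F.deg 0) →₀ MvPolynomial W K) :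
    F.aug (extend _ f g) =
      quotientRename hI' (restrictMap _ hf (quotientKill hI) F.aug g) := by
  refine apply_extend_eq hf (fun a ha => ?_) g
  obtain ⟨q, hq, hqa⟩ := F.aug_graded a
  rw [hqa, quotientKill_mk, quotientRename_mk, hq.rename_killCompl hf ha]

theorem restrictedAug_restrict (hI : I ≤ I'.comap (killHom K hf)) (g : F.ι 0 →₀ MvPolynomial V K) :
    restrictMap (supportedBasis f (F.deg 0)) hf (quotientKill hI) F.aug (restrict _ hf g) =
      quotientKill hI (F.aug g) := by
  refine restrictMap_restrict hf (fun a ha => ?_) g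
  obtain ⟨q, hq, hqa⟩ := F.aug_graded a
  rw [hqa, quotientKill_mk, hq.killCompl_eq_zero hf ha, map_zero]

/-- The restriction of a minimal resolution of `A/I` to the degrees that vanish outside the range
of `f`, which is a minimal resolution over the polynomial ring in the remaining variables. -/
noncomputable def restriction (hI : I ≤ I'.comap (killHom K hf))
    (hI' : I' ≤ I.comap (renameHom K f)) : MinimalResolution I' where
  ι i := supportedBasis f (F.deg i)
  finite_ι _ := inferInstance
  deg i a := F.deg i a ∘ f
  d := F.restrictedD hf
  aug := restrictMap _ hf (quotientKill hI) F.aug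
  d_graded i a c := by
    rw [restrictedD, restrictMap_single_one]
    exact (F.d_graded i a c).killCompl hf
  aug_graded a := by
    obtain ⟨q, hq, hqa⟩ := F.aug_graded a
    exact ⟨_, hq.killCompl hf, by rw [restrictMap_single_one, hqa, quotientKill_mk]⟩
  aug_surjective := by
    refine .of_comp (g := restrict _ hf) ?_
    convert (quotientKill_surjective hI).comp F.aug_surjective
    exact funext (F.restrictedAug_restrict hI)
  exact_zero := exact_of_retract F.exact_zero (Function.LeftInverse.surjective (restrict_extend hf))
    (restrict_extend hf) (map_zero _) (map_zero _) (F.restrictedD_restrict hf 0)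
    (F.restrictedAug_restrict hI) (F.aug_extend hI hI')
  exact_succ i := exact_of_retract (F.exact_succ i)
    (Function.LeftInverse.surjective (restrict_extend hf)) (restrict_extend hf) (map_zero _)
    (map_zero _) (F.restrictedD_restrict hf (i + 1)) (F.restrictedD_restrict hf i)
    (F.d_extend hf i)
  minimal i g c := by
    rw [← constantCoeff_rename f, ← extend_apply_coe, ← d_extend, F.minimal]

theorem rank_restriction (hI : I ≤ I'.comap (killHom K hf)) (hI' : I' ≤ I.comap (renameHom K f))
    (i : ℕ) {b : V → ℤ} (hb : Function.support b ⊆ Set.range f) :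
    (F.restriction hI hI').rank i (b ∘ f) = F.rank i b := by
  have hdeg : ∀ a : supportedBasis f (F.deg i), F.deg i a ∘ f = b ∘ f ↔ F.deg i a = b := by
    refine fun a => ⟨fun h => funext fun x => ?_, fun h => h ▸ rfl⟩
    by_cases hx : x ∈ Set.range f
    · obtain ⟨w, rfl⟩ := hx
      exact congrFun h w
    · rw [Function.notMem_support.1 fun h => hx (a.2 h),
        Function.notMem_support.1 fun h => hx (hb h)]
  refine Nat.card_congr ((Equiv.subtypeEquivRight hdeg).trans ?_)
  exact Equiv.subtypeSubtypeEquivSubtype (p := (· ∈ supportedBasis f (F.deg i)))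
    (q := (F.deg i · = b)) fun {a} (h : F.deg i a = b) =>
      (h ▸ hb : Function.support (F.deg i a) ⊆ Set.range f)

end MinimalResolution

section EdgeIdeal

variable {K : Type v} [Field K] {V : Type u} {W : Type w}

namespace SimpleHypergraph

/-- The embedding `f` of vertex sets identifies `H'` with the hypergraph that `H` induces on the
range of `f`. -/
def IsInducedEmbedding (H' : SimpleHypergraph W) (H : SimpleHypergraph V) (f : W ↪ V) : Prop :=
  ∀ e : Finset W, e.map f ∈ H.edges ↔ e ∈ H'.edges

theorem isInducedEmbedding_deleteVertex (H : SimpleHypergraph V) (x : V) :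
    (H.deleteVertex x).IsInducedEmbedding H (.subtype (· ≠ x)) :=
  fun _ => Iff.rfl

variable {H' : SimpleHypergraph W} {H : SimpleHypergraph V} {f : W ↪ V}

theorem IsInducedEmbedding.edgeIdeal_le_comap_rename (h : H'.IsInducedEmbedding H f) :
    H'.edgeIdeal K ≤ (H.edgeIdeal K).comap (renameHom K f) := by
  refine Ideal.span_le.2 ?_
  rintro _ ⟨e, he, rfl⟩
  exact Ideal.subset_span ⟨e.map f, (h e).2 he, by simp⟩

theorem IsInducedEmbedding.edgeIdeal_le_comap_killCompl (h : H'.IsInducedEmbedding H f) :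
    H.edgeIdeal K ≤ (H'.edgeIdeal K).comap (killHom K f.injective) := by
  refine Ideal.span_le.2 ?_
  rintro _ ⟨e, he, rfl⟩
  change killCompl f.injective (∏ x ∈ e, X x) ∈ H'.edgeIdeal K
  by_cases hrange : (e : Set V) ⊆ Set.range f
  · obtain ⟨e, rfl⟩ : ∃ e' : Finset W, e'.map f = e := by
      classical
      obtain ⟨e', -, he'⟩ :=
        Finset.subset_set_image_iff.1 (hrange.trans_eq Set.image_univ.symm)
      exact ⟨e', (Finset.map_eq_image f e').trans he'⟩
    have hrename : ∏ x ∈ e.map f, (X x : MvPolynomial V K) = rename f (∏ y ∈ e, X y) := by simp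
    rw [hrename, killCompl_rename_app]
    exact Ideal.subset_span ⟨e, (h e).1 he, rfl⟩
  · obtain ⟨x, hx, hxf⟩ := Set.not_subset.1 hrange
    rw [map_prod, Finset.prod_eq_zero hx (by rw [killCompl, aeval_X, dif_neg hxf])]
    exact zero_mem _

end SimpleHypergraph

variable [Finite V] (H : SimpleHypergraph V)

theorem multigradedBetti_eq_rank (F : MinimalResolution (H.edgeIdeal K)) (i : ℕ) (b : V → ℤ) :
    multigradedBetti K H i b = F.rank i b :=
  MinimalResolution.rank_eq H.isMultigraded_edgeIdeal _ F i b

theorem multigradedBetti_eq_zero_of_neg (i : ℕ) {b : V → ℤ} {x : V} (hx : b x < 0) :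
    multigradedBetti K H i b = 0 :=
  MinimalResolution.rank_eq_zero_of_neg _ i hx

variable {H}

theorem SimpleHypergraph.IsInducedEmbedding.multigradedBetti_comp [Finite W]
    {H' : SimpleHypergraph W} {f : W ↪ V} (h : H'.IsInducedEmbedding H f) (i : ℕ) {b : V → ℤ}
    (hb : Function.support b ⊆ Set.range f) :
    multigradedBetti K H' i (b ∘ f) = multigradedBetti K H i b := by
  rw [multigradedBetti_eq_rank H' (MinimalResolution.restriction _ h.edgeIdeal_le_comap_killCompl
    h.edgeIdeal_le_comap_rename)]
  exact MinimalResolution.rank_restriction _ _ _ i hb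

theorem multigradedBetti_deleteVertex (i : ℕ) {b : V → ℤ} {x : V} (hx : b x = 0) :
    multigradedBetti K (H.deleteVertex x) i (fun w => b w) = multigradedBetti K H i b := by
  refine (H.isInducedEmbedding_deleteVertex x).multigradedBetti_comp i fun y hy => ?_
  exact ⟨⟨y, fun hyx => hy (hyx ▸ hx)⟩, rfl⟩

end EdgeIdeal

section Deck

open Finset

theorem card_eq_sum_inv_card {α ι : Type*} [Fintype ι] (S : Finset α) (r : α → ι → Prop)
    [∀ b x, Decidable (r b x)] (hS : ∀ b ∈ S, ∃ x, r b x) :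
    (#S : ℚ) = ∑ x, ∑ b ∈ S with r b x, (#{y | r b y} : ℚ)⁻¹ := by
  simp only [sum_filter]
  rw [sum_comm, card_eq_sum_ones, Nat.cast_sum]
  refine sum_congr rfl fun b hb => ?_
  have hne : (#{y | r b y} : ℚ) ≠ 0 := by
    obtain ⟨x, hx⟩ := hS b hb
    exact Nat.cast_ne_zero.2 (card_ne_zero.2 ⟨x, by simpa using hx⟩)
  rw [← sum_filter, sum_const, nsmul_eq_mul, mul_inv_cancel₀ hne, Nat.cast_one]

theorem card_eq_of_deck {V V' M : Type*} [Finite V] [Zero M] {S : Finset (V → M)}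
    {S' : Finset (V' → M)} (hS : ∀ b ∈ S, ∃ x, b x = 0) (hS' : ∀ b ∈ S', ∃ x, b x = 0)
    (σ : V ≃ V') (g : V → V ≃ V') (hg : ∀ x, g x x = σ x)
    (h : ∀ x b, b x = 0 → (b ∈ S ↔ b ∘ (g x).symm ∈ S')) : #S = #S' := by
  classical
  have := Fintype.ofFinite V
  have := Fintype.ofEquiv V σ
  suffices (#S : ℚ) = #S' from mod_cast this
  rw [card_eq_sum_inv_card S (fun b x => b x = 0) hS,
    card_eq_sum_inv_card S' (fun b x => b x = 0) hS', ← σ.sum_comp]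
  refine sum_congr rfl fun x _ => ?_
  refine sum_equiv ((g x).arrowCongr (Equiv.refl M)) (fun b => ?_) (fun b _ => ?_)
  · have hx : (g x).arrowCongr (Equiv.refl M) b (σ x) = b x := by simp [← hg]
    simp only [mem_filter, hx]
    exact and_congr_left (h x b)
  · congr 2
    exact card_equiv (g x) (by simp)

theorem exists_equiv_extending {V V' : Type*} {x : V} {x' : V'}
    (f : {w // w ≠ x} ≃ {w // w ≠ x'}) :
    ∃ g : V ≃ V', g x = x' ∧ ∀ w : {w // w ≠ x}, g w = f w := by
  classical
  refine ⟨(Equiv.optionSubtypeNe x).symm.trans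
    ((Equiv.optionCongr f).trans (Equiv.optionSubtypeNe x')), by simp, fun w => ?_⟩
  simp [w.2]

theorem SimpleHypergraph.IsIsomorphic.exists_equiv_multigradedBetti {K : Type v} [Field K]
    {V : Type u} [Finite V] {V' : Type w} [Finite V'] {H : SimpleHypergraph V}
    {H' : SimpleHypergraph V'} {x : V} {x' : V'}
    (h : (H.deleteVertex x).IsIsomorphic (H'.deleteVertex x')) :
    ∃ g : V ≃ V', g x = x' ∧ ∀ b : V → ℤ, b x = 0 → ∀ i,
      multigradedBetti K H' i (b ∘ g.symm) = multigradedBetti K H i b := by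
  obtain ⟨f, hf : (H.deleteVertex x).IsInducedEmbedding (H'.deleteVertex x') f.toEmbedding⟩ := h
  obtain ⟨g, hgx, hg⟩ := exists_equiv_extending f
  refine ⟨g, hgx, fun b hb i => ?_⟩
  have hb' : (b ∘ g.symm) x' = 0 := by simp [← hgx, hb]
  rw [← multigradedBetti_deleteVertex i hb, ← multigradedBetti_deleteVertex i hb',
    ← hf.multigradedBetti_comp i fun y _ => f.surjective y]
  congr 1
  funext w
  simp [← hg]

theorem exists_le_zero {V : Type*} [Fintype V] {b : V → ℤ} (hb : ∑ x, b x < Fintype.card V) :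
    ∃ x, b x ≤ 0 := by
  by_contra! h
  refine hb.not_ge ?_
  simpa using sum_le_sum (s := univ) fun x _ => Int.add_one_le_of_lt (h x)

/-- The multidegrees of total degree `j` whose multigraded Betti numbers form the sequence `β`. -/
def degreesWithBetti (K : Type v) [Field K] {V : Type u} [Fintype V] (H : SimpleHypergraph V)
    (j : ℤ) (β : ℕ → ℕ) : Set (V → ℤ) :=
  {b | ∑ x, b x = j ∧ ∀ i, multigradedBetti K H i b = β i}

variable {K : Type v} [Field K] {V : Type u} [Fintype V] {V' : Type w} [Fintype V']
  {H : SimpleHypergraph V} {H' : SimpleHypergraph V'} {j : ℤ} {β : ℕ → ℕ}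

theorem nonneg_of_mem_degreesWithBetti (hβ : β ≠ 0) {b : V → ℤ}
    (hb : b ∈ degreesWithBetti K H j β) : 0 ≤ b := by
  intro x
  by_contra! hx
  exact hβ (funext fun i => by rw [← hb.2, multigradedBetti_eq_zero_of_neg H i hx, Pi.zero_apply])

theorem finite_degreesWithBetti (hβ : β ≠ 0) : (degreesWithBetti K H j β).Finite := by
  classical
  refine (Set.finite_Icc (0 : V → ℤ) fun _ => j).subset fun b hb => ?_
  have hnonneg := nonneg_of_mem_degreesWithBetti hβ hb
  refine ⟨hnonneg, fun x => ?_⟩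
  rw [← hb.1]
  exact single_le_sum (fun y _ => hnonneg y) (mem_univ x)

theorem exists_eq_zero_of_mem_degreesWithBetti (hβ : β ≠ 0) (hj : j < Fintype.card V) {b : V → ℤ}
    (hb : b ∈ degreesWithBetti K H j β) : ∃ x, b x = 0 := by
  obtain ⟨x, hx⟩ := exists_le_zero (hb.1.trans_lt hj)
  exact ⟨x, hx.antisymm (nonneg_of_mem_degreesWithBetti hβ hb x)⟩

theorem SimpleHypergraph.SameDeck.encard_degreesWithBetti (h : H.SameDeck H') (hβ : β ≠ 0)
    (hj : j < Fintype.card V) :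
    (degreesWithBetti K H j β).encard = (degreesWithBetti K H' j β).encard := by
  obtain ⟨σ, hσ⟩ := h
  have hj' : j < Fintype.card V' := by rwa [← Fintype.card_congr σ]
  choose g hgx hg using fun x => (hσ x).exists_equiv_multigradedBetti (K := K)
  rw [(finite_degreesWithBetti hβ).encard_eq_coe_toFinset_card,
    (finite_degreesWithBetti hβ).encard_eq_coe_toFinset_card, Nat.cast_inj]
  refine card_eq_of_deck (fun b hb => ?_) (fun b hb => ?_) σ g hgx fun x b hb => ?_
  · exact exists_eq_zero_of_mem_degreesWithBetti hβ hj ((Set.Finite.mem_toFinset _).1 hb)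
  · exact exists_eq_zero_of_mem_degreesWithBetti hβ hj' ((Set.Finite.mem_toFinset _).1 hb)
  · have hsum : ∑ y, (b ∘ (g x).symm) y = ∑ y, b y := (g x).symm.sum_comp b
    simp only [Set.Finite.mem_toFinset, degreesWithBetti, Set.mem_ofPred_eq, hg x b hb, hsum]

end Deck

end HypergraphReconstruction

open HypergraphReconstruction in
theorem proposition4p7_general {K : Type*} [Field K] {V V' : Type*} [Fintype V] [Fintype V']
    (H : SimpleHypergraph V) :
    (∀ (b : V → ℤ) (i : ℕ),
      (∀ x, b x = 0 →
        multigradedBetti K H i b = multigradedBetti K (H.deleteVertex x) i (fun w => b w)) ∧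
      (∑ x, b x < Fintype.card V → (∀ x, b x ≠ 0) → multigradedBetti K H i b = 0)) ∧
    (∀ H' : SimpleHypergraph V', H.SameDeck H' →
      ∀ j : ℤ, j < Fintype.card V → ∀ β : ℕ → ℕ, β ≠ 0 →
        {b : V → ℤ | ∑ x, b x = j ∧ ∀ i, multigradedBetti K H i b = β i}.encard =
        {b : V' → ℤ | ∑ x, b x = j ∧ ∀ i, multigradedBetti K H' i b = β i}.encard) := by
  refine ⟨fun b i => ⟨fun x hx => (multigradedBetti_deleteVertex i hx).symm, fun hb hne => ?_⟩,
    fun H' h j hj β hβ => h.encard_degreesWithBetti hβ hj⟩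
  obtain ⟨x, hx⟩ := exists_le_zero hb
  exact multigradedBetti_eq_zero_of_neg H i (hx.lt_of_ne (hne x))

theorem proposition4p7 {K : Type*} [Field K] [CharZero K] {V V' : Type*} [Fintype V] [Fintype V']
    (hn : 3 ≤ Fintype.card V) (H : HypergraphReconstruction.SimpleHypergraph V) :
    (∀ b : V → ℤ, ∑ x, b x < Fintype.card V → ∀ i : ℕ,
      (∀ x, b x = 0 →
        HypergraphReconstruction.multigradedBetti K H i b =
          HypergraphReconstruction.multigradedBetti K (H.deleteVertex x) i (fun w => b w)) ∧
      ((∀ x, b x ≠ 0) → HypergraphReconstruction.multigradedBetti K H i b = 0)) ∧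
    (∀ H' : HypergraphReconstruction.SimpleHypergraph V', H.SameDeck H' →
      ∀ j : ℤ, j < Fintype.card V → ∀ β : ℕ → ℕ, β ≠ 0 →
        {b : V → ℤ | ∑ x, b x = j ∧
          ∀ i, HypergraphReconstruction.multigradedBetti K H i b = β i}.encard =
        {b : V' → ℤ | ∑ x, b x = j ∧
          ∀ i, HypergraphReconstruction.multigradedBetti K H' i b = β i}.encard) := by
  obtain ⟨hcards, hdeck⟩ := proposition4p7_general (K := K) (V' := V') H
  exact ⟨fun b hb i => ⟨(hcards b i).1, (hcards b i).2 hb⟩, hdeck⟩
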